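/- Let $r,h\ge 1$ be integers. An $r$-graph is a hypergraph all of whose edges have exactly $r$ vertices, and $K_n^{(r)}$ is the complete $r$-graph on $n$ vertices. For an $r$-graph $H$, an $(n,r,H)$-local coloring with $k$ colors is a family of edge-colorings $f_v:E(K_n^{(r)})\to\{1,\dots,k\}$, one for each vertex $v$ of $K_n^{(r)}$, such that every copy $T$ of $H$ in $K_n^{(r)}$ has a vertex $u\in V(T)$ for which no two edges of $T$ have the same color under $f_u$. Let $C_r(n,H)$ be the least $k$ for which such a family exists. Let $H$ be an $r$-graph with $h$ vertices and let $\sigma:V(H)\to\{1,\dots,h\}$ be a bijection. For $x\in V(H)$ and $1\le i\le r$, let $T_x^i$ be the set of edges $e\ni x$ of $H$ containing exactly $i-1$ vertices $v$ with $\sigma(v)<\sigma(x)$; for $r+1\le i\le 2r+1$, let $T_x^i$ be the set of edges $e\not\ni x$ of $H$ containing exactly $i-r-1$ vertices $v$ with $\sigma(v)<\sigma(x)$. The $r$-graph $H$ is called 2-locally large if there is a bijection $\sigma$ such that for every $x\in V(H)$ at least one of the sets $T_x^1,\dots,T_x^{2r+1}$ has at least two elements. Write $\log^{(i)}$ for the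 $i$-fold iterated natural logarithm. **Theorem.** For all integers $r,h\ge 1$ there is a constant $c=c(r,h)>0$ such that for every $r$-graph $H$ with $h$ vertices: 1. if $H$ is not 2-locally large, then $C_r(n,H)\le 2r+1$ for every $n$; 2. if $H$ is 2-locally large, then $$C_r(n,H)\ \ge\ c\left(\frac{\log^{(r)} n}{\log^{(r+1)} n}\right)^{\frac1{(r+1)^2}}$$ for every $n$ for which $\log^{(1)}n,\dots,\log^{(r+1)}n$ are all defined and positive (in particular, for all sufficiently large $n$). Consequently, $C_r(n,H)$ is bounded by a constant independent of $n$ if and only if $H$ is not 2-locally large. -/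

import Mathlib

namespace LocalRainbow

universe u

/-- `H` is an `r`-graph: every edge has exactly `r` vertices. -/
def IsRGraph {α : Type u} (H : Hypergraph α) (r : ℕ) : Prop :=
  ∀ e ∈ H.edgeSet, e.encard = r

/-- The complete `r`-uniform hypergraph `K_n^{(r)}` on the vertex set `Fin n`. -/
def completeRGraph (n r : ℕ) : Hypergraph (Fin n) where
  vertexSet := Set.univ
  edgeSet := {e | e.encard = r}
  subset_vertexSet_of_mem_edgeSet' := fun e _ => Set.subset_univ e

/-- `T` is a copy of `H` in `G`: a subhypergraph of `G` that is the image of `H` under a map that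
is injective on the vertices of `H`. -/
def IsCopy {α β : Type*} (H : Hypergraph α) (G T : Hypergraph β) : Prop :=
  T.vertexSet ⊆ G.vertexSet ∧ T.edgeSet ⊆ G.edgeSet ∧
    ∃ φ : α → β, Set.InjOn φ H.vertexSet ∧ H.image φ = T

/-- An edge-coloring `g` of `G` is rainbow on `T`: no two edges of `T` get the same color. -/
def IsRainbowOn {β C : Type*} {G : Hypergraph β} (g : G.edgeSet → C) (T : Hypergraph β) : Prop :=
  ∀ e₁ e₂ : G.edgeSet, (e₁ : Set β) ∈ T.edgeSet → (e₂ : Set β) ∈ T.edgeSet → e₁ ≠ e₂ → g e₁ ≠ g e₂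

/-- The family `f` of edge-colorings of `K_n^{(r)}` with `k` colors, one for each vertex, is an
`(n, r, H)`-local coloring. -/
def IsLocalColoring {α : Type u} (H : Hypergraph α) {n r k : ℕ}
    (f : Fin n → (completeRGraph n r).edgeSet → Fin k) : Prop :=
  ∀ T : Hypergraph (Fin n), IsCopy H (completeRGraph n r) T →
    ∃ u ∈ T.vertexSet, IsRainbowOn (f u) T

/-- The local rainbow coloring number `C_r(n, H)`. -/
noncomputable def localRainbowNumber {α : Type u} (r n : ℕ) (H : Hypergraph α) : ℕ :=
  sInf {k : ℕ | ∃ f : Fin n → (completeRGraph n r).edgeSet → Fin k, IsLocalColoring H f}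

/-- The infimum defining `C_r(n, H)` is over a nonempty set as soon as `H` has a vertex. -/
theorem exists_isLocalColoring {α : Type u} (r n : ℕ) (H : Hypergraph α)
    (hV : H.vertexSet.Nonempty) :
    ∃ k : ℕ, ∃ f : Fin n → (completeRGraph n r).edgeSet → Fin k, IsLocalColoring H f := by
  obtain ⟨k, ⟨eq⟩⟩ := Finite.exists_equiv_fin (completeRGraph n r).edgeSet
  refine ⟨k, fun _ => eq, ?_⟩
  rintro T ⟨-, -, φ, -, rfl⟩
  obtain ⟨v, hv⟩ := hV
  exact ⟨φ v, Set.mem_image_of_mem φ hv, fun e₁ e₂ _ _ hne h => hne (eq.injective h)⟩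

/-- The set `T_x^i` of edges of the `r`-graph `H`, with respect to the vertex labelling `σ`.
For `1 ≤ i ≤ r` it consists of the edges `e` containing `x` in which `x` comes at the `i`-th place;
for `r + 1 ≤ i ≤ 2 r + 1` of the edges `e` not containing `x` such that `x` would come at the
`(i - r)`-th place in `e ∪ {x}`. -/
def edgeClass {α : Type u} (H : Hypergraph α) (r : ℕ) (σ : α → ℕ) (x : α) (i : ℕ) :
    Set (Set α) :=
  {e ∈ H.edgeSet |
    (1 ≤ i ∧ i ≤ r ∧ x ∈ e ∧ {v ∈ e | σ v < σ x}.ncard + 1 = i) ∨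
    (r + 1 ≤ i ∧ i ≤ 2 * r + 1 ∧ x ∉ e ∧ {v ∈ e | σ v < σ x}.ncard + 1 + r = i)}

/-- The `r`-graph `H` is 2-locally large. -/
def IsTwoLocallyLarge {α : Type u} (H : Hypergraph α) (r : ℕ) : Prop :=
  ∃ σ : α → ℕ, Set.BijOn σ H.vertexSet (Set.Icc 1 H.vertexSet.ncard) ∧
    ∀ x ∈ H.vertexSet, ∃ i ∈ Set.Icc 1 (2 * r + 1), 2 ≤ (edgeClass H r σ x i).encard

/-- `log^{(i)} n`, the `i`-fold iterated natural logarithm. -/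
noncomputable def iterLog (i n : ℕ) : ℝ := Real.log^[i] (n : ℝ)

end LocalRainbow

/-! Upper bound: let each vertex color an edge by its position relative to it, which takes `2 * r +
1` values. If some copy of `H` has no rainbow vertex, the order of its vertices is a labelling that
makes `H` 2-locally large (`isLocalColoring_positionColoring`).

Lower bound: given a local coloring with `k` colors, record on each `(r + 1)`-set the colors its
members give to the `r`-sets inside it, using `k ^ (2 * r + 1)` colors. On a homogeneous set, the
color a vertex gives to an edge depends only on relative position
(`exists_color_determined_by_rank`), so a 2-locally large `H` embedded along its labelling has no
rainbow vertex. Hence `n` is below a Ramsey number (`lt_ramseyBound_of_isLocalColoring`), and the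
Erdős–Rado bound is a tower of height `r` over a multiple of `k ^ (r + 1) ^ 2`. -/

namespace LocalRainbow

open Finset

/-! ### Erdős–Rado bound and position-determined colors -/

section Ramsey

variable {V κ : Type*} [LinearOrder V]

/-- All `s`-element subsets of `S` have the same color under `c`. -/
def IsHomogeneous (c : Finset V → κ) (s : ℕ) (S : Finset V) : Prop :=
  ∀ A B : Finset V, A ⊆ S → B ⊆ S → #A = s → #B = s → c A = c B

/-- For every `s`-element subset `A` of `Y`, the color of `A ∪ {y}` does not depend on the element
`y` of `Z` above `A`. -/
def IsEndHomogeneous (c : Finset V → κ) (s : ℕ) (Y Z : Finset V) : Prop :=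
  ∀ A ⊆ Y, #A = s → ∀ y ∈ Z, ∀ z ∈ Z, (∀ a ∈ A, a < y) → (∀ a ∈ A, a < z) →
    c (insert y A) = c (insert z A)

/-- Greedy construction: `Y` is the part already chosen, `Z` a reservoir above it. The least `x` of
`Z` moves to `Y`, and the rest of `Z` is thinned by pigeonhole so that the color of `A ∪ {x, z}`,
for `t`-sets `A` in `Y`, no longer depends on `z`. As `#Y ≤ M`, there are at most `P` patterns; the
factor 2 pays for removing `x`. -/
theorem exists_isEndHomogeneous_of_le [Fintype κ] [Nonempty κ] (c : Finset V → κ) (t M j : ℕ)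
    (Y Z : Finset V) (hY : #Y + j ≤ M)
    (hZ : (2 * Fintype.card κ ^ M ^ t) ^ j ≤ #Z) (hlt : ∀ y ∈ Y, ∀ z ∈ Z, y < z)
    (hhom : IsEndHomogeneous c (t + 1) Y (Y ∪ Z)) :
    ∃ Y' ⊆ Y ∪ Z, #Y' = #Y + j ∧ IsEndHomogeneous c (t + 1) Y' Y' := by
  classical
  induction j generalizing Y Z with
  | zero =>
    exact ⟨Y, subset_union_left, rfl, fun A hA hs y hy z hz =>
      hhom A hA hs y (mem_union_left _ hy) z (mem_union_left _ hz)⟩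
  | succ j ih =>
    set P := Fintype.card κ ^ M ^ t with hP
    have hκ : 0 < Fintype.card κ := Fintype.card_pos
    have hPpos : 0 < P := by positivity
    have hQ : 0 < P * (2 * P) ^ j := by positivity
    have hpow : (2 * P) ^ (j + 1) = 2 * (P * (2 * P) ^ j) := by ring
    have hne : Z.Nonempty := card_pos.1 (by omega)
    set x := Z.min' hne
    have hxZ : x ∈ Z := Z.min'_mem hne
    have hxlt : ∀ z ∈ Z.erase x, x < z := fun z hz => Z.min'_lt_of_mem_erase_min' hne hz
    have hxY : x ∉ Y := fun h => (hlt x h x hxZ).false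
    let F : V → (Y.powersetCard t → κ) := fun z A => c (insert z (insert x A.1))
    have hcard : Fintype.card (Y.powersetCard t → κ) ≤ P := by
      rw [Fintype.card_fun, Fintype.card_coe, card_powersetCard]
      exact Nat.pow_le_pow_right hκ
        ((Nat.choose_le_pow _ _).trans (Nat.pow_le_pow_left (by omega) t))
    obtain ⟨q, -, hq⟩ := exists_le_card_fiber_of_mul_le_card_of_maps_to
      (s := Z.erase x) (t := univ) (f := F) (n := (2 * P) ^ j) (fun _ _ => mem_univ _)
      univ_nonempty (by
        rw [card_univ, card_erase_of_mem hxZ]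
        have := Nat.mul_le_mul_right ((2 * P) ^ j) hcard
        omega)
    set Z' := {z ∈ Z.erase x | F z = q} with hZ'
    have hZ'Z : ∀ z ∈ Z', z ∈ Z := fun z hz => mem_of_mem_erase (mem_filter.1 hz).1
    have hsub : insert x Y ∪ Z' ⊆ Y ∪ Z := by
      intro z hz
      simp only [mem_union, mem_insert] at hz ⊢
      rcases hz with (rfl | hz) | hz
      · exact .inr hxZ
      · exact .inl hz
      · exact .inr (hZ'Z z hz)
    have hcardY : #(insert x Y) = #Y + 1 := card_insert_of_notMem hxY
    obtain ⟨Y', hY', hYc, hYh⟩ := ih (insert x Y) Z' (by omega) hq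
      (by
        intro y hy z hz
        rcases mem_insert.1 hy with rfl | hy
        · exact hxlt z (mem_filter.1 hz).1
        · exact hlt y hy z (hZ'Z z hz))
      (by
        intro A hA hs y hy z hz hyA hzA
        by_cases hxA : x ∈ A
        · have key : ∀ w ∈ insert x Y ∪ Z', (∀ a ∈ A, a < w) → w ∈ Z' := by
            intro w hw hwA
            have := hwA x hxA
            simp only [mem_union, mem_insert] at hw
            rcases hw with (rfl | hw) | hw
            · exact absurd this (lt_irrefl _)
            · exact absurd (this.trans (hlt w hw x hxZ)) (lt_irrefl _)
            · exact hw
          have hAe : A.erase x ∈ Y.powersetCard t :=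
            mem_powersetCard.2 ⟨subset_insert_iff.1 hA, by rw [card_erase_of_mem hxA]; omega⟩
          have hF : F y = F z :=
            (mem_filter.1 (key y hy hyA)).2.trans (mem_filter.1 (key z hz hzA)).2.symm
          have := congrFun hF ⟨A.erase x, hAe⟩
          simpa only [F, insert_erase hxA] using this
        · exact hhom A ((subset_insert_iff_of_notMem hxA).1 hA) hs y (hsub hy) z (hsub hz)
            hyA hzA)
    exact ⟨Y', hY'.trans hsub, by omega, hYh⟩

/-- An upper bound of Erdős–Rado type for the Ramsey number of `(t + 1)`-uniform hypergraphs with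
`K` colors and homogeneous sets of size `h`. -/
def ramseyBound (K h : ℕ) : ℕ → ℕ
  | 0 => K * h
  | t + 1 => (2 * K) ^ ramseyBound K h t ^ (t + 1)

/-- On an end-homogeneous set the color of a `(t + 2)`-set is determined by the set without its
maximum, which reduces the uniformity by one. -/
theorem exists_isHomogeneous_of_ramseyBound_le [Fintype κ] [Nonempty κ] (h t : ℕ)
    (c : Finset V → κ) (X : Finset V) (hX : ramseyBound (Fintype.card κ) h t ≤ #X) :
    ∃ S ⊆ X, #S = h ∧ IsHomogeneous c (t + 1) S := by
  classical
  induction t generalizing c X with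
  | zero =>
    obtain ⟨q, -, hq⟩ := exists_le_card_fiber_of_mul_le_card_of_maps_to
      (s := X) (t := univ) (f := fun x => c {x}) (n := h) (fun _ _ => mem_univ _)
      univ_nonempty (by rw [card_univ]; exact hX)
    obtain ⟨S, hS, hSc⟩ := exists_subset_card_eq hq
    refine ⟨S, hS.trans (filter_subset _ _), hSc, fun A B hA hB hAc hBc => ?_⟩
    obtain ⟨a, rfl⟩ := card_eq_one.1 hAc
    obtain ⟨b, rfl⟩ := card_eq_one.1 hBc
    exact (mem_filter.1 (hS (hA (mem_singleton_self a)))).2.trans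
      (mem_filter.1 (hS (hB (mem_singleton_self b)))).2.symm
  | succ t ih =>
    set M := ramseyBound (Fintype.card κ) h t with hM
    have hκ : 0 < Fintype.card κ := Fintype.card_pos
    have hbound : (2 * Fintype.card κ ^ M ^ t) ^ M ≤ #X := by
      refine le_trans ?_ hX
      change _ ≤ (2 * Fintype.card κ) ^ M ^ (t + 1)
      rcases Nat.eq_zero_or_pos M with h0 | hpos
      · rw [h0]; simp
      · rw [pow_succ, pow_mul (2 * _), mul_pow 2 (Fintype.card κ) (M ^ t)]
        have : 2 ≤ 2 ^ M ^ t := Nat.le_self_pow (by positivity) 2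
        gcongr
    obtain ⟨Y, hYX, hYc, hY⟩ := exists_isEndHomogeneous_of_le c t M M ∅ X (by simp) hbound
      (by simp) (by
        intro A hA hs
        rw [subset_empty.1 hA] at hs
        simp at hs)
    rw [empty_union] at hYX
    rw [card_empty, zero_add] at hYc
    -- The chosen `y` is immaterial by end-homogeneity. The default branch is never met below: the
    -- removed maximum is a witness.
    let c' : Finset V → κ := fun A =>
      if hA : ∃ y ∈ Y, ∀ a ∈ A, a < y then c (insert hA.choose A) else c A
    obtain ⟨S, hSY, hSc, hS⟩ := ih c' Y hYc.ge
    have key : ∀ A ⊆ S, #A = t + 1 + 1 → ∃ B ⊆ S, #B = t + 1 ∧ c A = c' B := by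
      intro A hA hAc
      have hne : A.Nonempty := card_pos.1 (by omega)
      set m := A.max' hne
      have hm : m ∈ A := A.max'_mem hne
      have hBc : #(A.erase m) = t + 1 := by rw [card_erase_of_mem hm]; omega
      have hlt : ∀ a ∈ A.erase m, a < m := fun a ha => A.lt_max'_of_mem_erase_max' hne ha
      have hex : ∃ y ∈ Y, ∀ a ∈ A.erase m, a < y := ⟨m, hSY (hA hm), hlt⟩
      refine ⟨A.erase m, (erase_subset _ _).trans hA, hBc, ?_⟩
      simp only [c', dif_pos hex]
      rw [← hY (A.erase m) (((erase_subset _ _).trans hA).trans hSY) hBc m (hSY (hA hm)) _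
        hex.choose_spec.1 hlt hex.choose_spec.2, insert_erase hm]
    refine ⟨S, hSY.trans hYX, hSc, fun A B hA hB hAc hBc => ?_⟩
    obtain ⟨A', hA', hAc', hAe⟩ := key A hA hAc
    obtain ⟨B', hB', hBc', hBe⟩ := key B hB hBc
    rw [hAe, hBe, hS A' B' hA' hB' hAc' hBc']

/-- The number of elements of `e` below `x`. -/
def rank (x : V) (e : Finset V) : ℕ := #{v ∈ e | v < x}

theorem rank_lt_rank {e : Finset V} {x y : V} (hx : x ∈ e) (hxy : x < y) :
    rank x e < rank y e := by
  refine card_lt_card (Finset.ssubset_iff_of_subset ?_ |>.2 ⟨x, ?_, ?_⟩)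
  · exact fun v hv => mem_filter.2 ⟨(mem_filter.1 hv).1, (mem_filter.1 hv).2.trans hxy⟩
  · exact mem_filter.2 ⟨hx, hxy⟩
  · simp

theorem rank_injOn {e : Finset V} {x y : V} (hx : x ∈ e) (hy : y ∈ e)
    (h : rank x e = rank y e) : x = y := by
  rcases lt_trichotomy x y with hxy | hxy | hxy
  · exact absurd h (rank_lt_rank hx hxy).ne
  · exact hxy
  · exact absurd h (rank_lt_rank hy hxy).ne'

theorem rank_lt_card {e : Finset V} {x : V} (hx : x ∈ e) : rank x e < #e :=
  card_lt_card ((filter_ssubset).2 ⟨x, hx, lt_irrefl x⟩)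

theorem rank_le_card (e : Finset V) (x : V) : rank x e ≤ #e := card_filter_le _ _

theorem rank_insert_self (e : Finset V) (x : V) : rank x (insert x e) = rank x e := by
  simp [rank, filter_insert]

open Classical in
/-- The value of `ψ` at the element of rank `j` of `e`. -/
noncomputable def valueAtRank {C : Type*} [Inhabited C] (ψ : V → C) (e : Finset V) (j : ℕ) : C :=
  if h : ∃ x ∈ e, rank x e = j then ψ h.choose else default

theorem valueAtRank_rank {C : Type*} [Inhabited C] (ψ : V → C) {e : Finset V} {x : V}
    (hx : x ∈ e) : valueAtRank ψ e (rank x e) = ψ x := by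
  have h : ∃ y ∈ e, rank y e = rank x e := ⟨x, hx, rfl⟩
  rw [valueAtRank, dif_pos h, rank_injOn h.choose_spec.1 hx h.choose_spec.2]

/-- In a large enough set one finds a subset `S` of size `h` on which the color `g x e` of an
`r`-subset `e` with respect to a vertex `x` depends only on the position of `x` relative to `e`. -/
theorem exists_color_determined_by_rank {k : ℕ} [NeZero k] (r h : ℕ) (g : V → Finset V → Fin k)
    (X : Finset V) (hX : ramseyBound (k ^ (2 * r + 1)) (h + 1) r ≤ #X) :
    ∃ S ⊆ X, #S = h ∧ ∀ x ∈ S, ∀ e ⊆ S, ∀ e' ⊆ S, #e = r → #e' = r → (x ∈ e ↔ x ∈ e') →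
      rank x e = rank x e' → g x e = g x e' := by
  -- The first component of `c` treats `x ∉ e` through `B = e ∪ {x}`. The second treats `x ∈ e`,
  -- with `e` completed to an `(r + 1)`-set by a larger element.
  let dropMax : Finset V → Finset V := fun B => {v ∈ B | ∃ w ∈ B, v < w}
  let c : Finset V → (Fin (r + 1) → Fin k) × (Fin r → Fin k) := fun B =>
    (fun j => valueAtRank (fun x => g x (B.erase x)) B j,
     fun j => valueAtRank (fun x => g x (dropMax B)) (dropMax B) j)
  have hcard : Fintype.card ((Fin (r + 1) → Fin k) × (Fin r → Fin k)) = k ^ (2 * r + 1) := by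
    simp only [Fintype.card_prod, Fintype.card_fun, Fintype.card_fin]
    ring
  obtain ⟨S, hSX, hSc, hS⟩ := exists_isHomogeneous_of_ramseyBound_le (h + 1) r c X
    (by rw [hcard]; exact hX)
  have hne : S.Nonempty := card_pos.1 (by omega)
  -- The maximum is reserved as that larger element for every `e`; hence `h + 1`.
  set m := S.max' hne
  have hm : m ∈ S := S.max'_mem hne
  have hlt : ∀ a ∈ S.erase m, a < m := fun a ha => S.lt_max'_of_mem_erase_max' hne ha
  have hmem : ∀ e ⊆ S.erase m, m ∉ e := fun e he h => notMem_erase m S (he h)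
  have hdrop : ∀ e ⊆ S.erase m, dropMax (insert m e) = e := by
    intro e he
    ext v
    simp only [dropMax, mem_filter, mem_insert]
    constructor
    · rintro ⟨rfl | hv, w, rfl | hw, hvw⟩
      · exact absurd hvw (lt_irrefl _)
      · exact absurd (hvw.trans (hlt w (he hw))) (lt_irrefl _)
      · exact hv
      · exact hv
    · exact fun hv => ⟨.inr hv, m, .inl rfl, hlt v (he hv)⟩
  refine ⟨S.erase m, (erase_subset _ _).trans hSX, by rw [card_erase_of_mem hm]; omega, ?_⟩
  intro x hx e he e' he' hec hec' hiff hrank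
  by_cases hxe : x ∈ e
  · have hxe' := hiff.1 hxe
    have hc := hS (insert m e) (insert m e')
      (insert_subset hm (he.trans (erase_subset _ _)))
      (insert_subset hm (he'.trans (erase_subset _ _)))
      (by rw [card_insert_of_notMem (hmem e he), hec])
      (by rw [card_insert_of_notMem (hmem e' he'), hec'])
    have h2 := congrFun (congrArg Prod.snd hc) ⟨rank x e, hec ▸ rank_lt_card hxe⟩
    simp only [c, hdrop e he, hdrop e' he'] at h2
    rw [valueAtRank_rank _ hxe, hrank, valueAtRank_rank _ hxe'] at h2
    exact h2
  · have hxe' : x ∉ e' := fun h => hxe (hiff.2 h)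
    have hxS := mem_of_mem_erase hx
    have hc := hS (insert x e) (insert x e')
      (insert_subset hxS (he.trans (erase_subset _ _)))
      (insert_subset hxS (he'.trans (erase_subset _ _)))
      (by rw [card_insert_of_notMem hxe, hec])
      (by rw [card_insert_of_notMem hxe', hec'])
    have h2 := congrFun (congrArg Prod.fst hc)
      ⟨rank x e, Nat.lt_succ_of_le (hec ▸ rank_le_card e x)⟩
    simp only [c] at h2
    rw [← rank_insert_self e, valueAtRank_rank _ (mem_insert_self x e), rank_insert_self, hrank,
      ← rank_insert_self e', valueAtRank_rank _ (mem_insert_self x e'), erase_insert hxe,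
      erase_insert hxe'] at h2
    exact h2

end Ramsey

/-! ### Tower estimates and iterated logarithms -/

section Tower

theorem one_le_iterate_exp {x : ℝ} (hx : 1 ≤ x) (j : ℕ) : 1 ≤ Real.exp^[j] x := by
  induction j with
  | zero => exact hx
  | succ j ih =>
    rw [Function.iterate_succ_apply']
    exact Real.one_le_exp (zero_le_one.trans ih)

theorem strictMono_iterate_exp (j : ℕ) : StrictMono (Real.exp^[j]) :=
  Real.exp_strictMono.iterate j

/-- For `y ≥ 1`, `p ≤ 1 + (p - 1) * y ≤ exp ((p - 1) * y)`, so a factor `p` can be pushed down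
through every exponential. -/
theorem mul_iterate_exp_le {p x : ℝ} (hp : 1 ≤ p) (hx : 1 ≤ x) (j : ℕ) :
    p * Real.exp^[j] x ≤ Real.exp^[j] (p * x) := by
  induction j with
  | zero => exact le_rfl
  | succ j ih =>
    rw [Function.iterate_succ_apply', Function.iterate_succ_apply']
    set y := Real.exp^[j] x
    have hy : 1 ≤ y := one_le_iterate_exp hx j
    have h1 : p ≤ Real.exp ((p - 1) * y) := by
      have := Real.add_one_le_exp ((p - 1) * y)
      nlinarith
    calc p * Real.exp y ≤ Real.exp ((p - 1) * y) * Real.exp y := by gcongr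
      _ = Real.exp (p * y) := by rw [← Real.exp_add]; ring_nf
      _ ≤ _ := Real.exp_le_exp.2 ih

theorem iterate_exp_pow_le {p : ℕ} {x : ℝ} (hp : 1 ≤ p) (hx : 1 ≤ x) (j : ℕ) :
    (Real.exp^[j + 1] x) ^ p ≤ Real.exp^[j + 1] (p * x) := by
  rw [Function.iterate_succ_apply', Function.iterate_succ_apply', ← Real.exp_nat_mul]
  exact Real.exp_le_exp.2 (mul_iterate_exp_le (by exact_mod_cast hp) hx j)

theorem ramseyBound_pos {K h : ℕ} (hK : 1 ≤ K) (hh : 1 ≤ h) (t : ℕ) : 0 < ramseyBound K h t := by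
  cases t <;> simp only [ramseyBound] <;> positivity

theorem cast_ramseyBound_succ {K h : ℕ} (hK : 1 ≤ K) (t : ℕ) :
    (ramseyBound K h (t + 1) : ℝ) =
      Real.exp (ramseyBound K h t ^ (t + 1) * Real.log (2 * K)) := by
  have hK' : (0 : ℝ) < K := by exact_mod_cast hK
  have := Real.exp_nat_mul (Real.log (2 * K)) (ramseyBound K h t ^ (t + 1))
  rw [Real.exp_log (by positivity)] at this
  push_cast at this
  rw [this]
  simp [ramseyBound]

/-- Above the bottom level `log (2 * K)` is absorbed by one more factor of the previous bound, and
powers pass to the innermost argument. Thus only `a` grows with `t`. -/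
theorem exists_ramseyBound_le (t : ℕ) :
    ∃ a : ℝ, 1 ≤ a ∧ ∀ K h : ℕ, 1 ≤ K → 1 ≤ h → ∀ L : ℝ, 1 ≤ L → Real.log (2 * K) ≤ L →
      (ramseyBound K h (t + 1) : ℝ) ≤ Real.exp^[t + 1] (a * (K * h * L)) := by
  induction t with
  | zero =>
    refine ⟨1, le_rfl, fun K h hK hh L hL hlog => ?_⟩
    rw [cast_ramseyBound_succ hK]
    simp only [ramseyBound, Function.iterate_one, zero_add, pow_one, one_mul]
    push_cast
    gcongr
  | succ t ih =>
    obtain ⟨a, ha, hab⟩ := ih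
    refine ⟨((t + 3 : ℕ) : ℝ) * a, ?_, fun K h hK hh L hL hlog => ?_⟩
    · have : (1 : ℝ) ≤ ((t + 3 : ℕ) : ℝ) := by exact_mod_cast (by omega : 1 ≤ t + 3)
      nlinarith
    have hK' : (1 : ℝ) ≤ K := by exact_mod_cast hK
    have hh' : (1 : ℝ) ≤ h := by exact_mod_cast hh
    have hX : 1 ≤ a * (K * h * L) :=
      one_le_mul_of_one_le_of_one_le ha
        (one_le_mul_of_one_le_of_one_le (one_le_mul_of_one_le_of_one_le hK' hh') hL)
    have hlogR : Real.log (2 * K) ≤ ramseyBound K h (t + 1) := by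
      have h1 : 2 * K ≤ ramseyBound K h (t + 1) :=
        Nat.le_self_pow (pow_ne_zero _ (ramseyBound_pos hK hh t).ne') _
      have h2 : ((2 * K : ℕ) : ℝ) ≤ ramseyBound K h (t + 1) := by exact_mod_cast h1
      push_cast at h2
      exact (Real.log_le_self (by positivity)).trans h2
    rw [cast_ramseyBound_succ hK, Function.iterate_succ_apply']
    refine Real.exp_le_exp.2 ?_
    calc (ramseyBound K h (t + 1) : ℝ) ^ (t + 1 + 1) * Real.log (2 * K)
        ≤ (ramseyBound K h (t + 1) : ℝ) ^ (t + 1 + 1) * ramseyBound K h (t + 1) := by gcongr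
      _ = (ramseyBound K h (t + 1) : ℝ) ^ (t + 3) := by ring
      _ ≤ (Real.exp^[t + 1] (a * (K * h * L))) ^ (t + 3) := by
          gcongr
          exact hab K h hK hh L hL hlog
      _ ≤ Real.exp^[t + 1] ((t + 3 : ℕ) * (a * (K * h * L))) :=
          iterate_exp_pow_le (by omega) hX t
      _ = _ := by rw [mul_assoc _ a]

/-- With `k ^ (2 * r + 1)` colors, the Ramsey bound is a tower of height `r` over a multiple of
`k ^ (r + 1) ^ 2`. -/
theorem exists_ramseyBound_pow_le (r h : ℕ) (hr : 1 ≤ r) :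
    ∃ D : ℝ, 0 < D ∧ ∀ k : ℕ, 1 ≤ k →
      (ramseyBound (k ^ (2 * r + 1)) (h + 1) r : ℝ) ≤
        Real.exp^[r] (D * (k : ℝ) ^ ((r + 1) ^ 2)) := by
  obtain ⟨t, rfl⟩ : ∃ t, r = t + 1 := ⟨r - 1, by omega⟩
  obtain ⟨a, ha, hab⟩ := exists_ramseyBound_le t
  set r := t + 1 with hrt
  refine ⟨a * ((h + 1) * (2 * r + 2)), by positivity, fun k hk => ?_⟩
  have hk' : (1 : ℝ) ≤ k := by exact_mod_cast hk
  have hL : (1 : ℝ) ≤ (2 * r + 2) * k := by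
    have : (0 : ℝ) ≤ r := by positivity
    nlinarith
  have hlog : Real.log (2 * ((k ^ (2 * r + 1) : ℕ) : ℝ)) ≤ (2 * r + 2) * k := by
    push_cast
    rw [Real.log_mul (by norm_num) (by positivity), Real.log_pow]
    have h1 : Real.log 2 ≤ 1 := by linarith [Real.log_two_lt_d9]
    have h2 : Real.log k ≤ k := Real.log_le_self (by positivity)
    have h3 : ((2 * r + 1 : ℕ) : ℝ) * Real.log k ≤ ((2 * r + 1 : ℕ) : ℝ) * k := by gcongr
    push_cast at h3 ⊢
    linarith
  refine (hab (k ^ (2 * r + 1)) (h + 1) (Nat.one_le_pow _ _ hk) (by omega) _ hL hlog).trans ?_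
  refine (strictMono_iterate_exp _).monotone ?_
  -- `K` has degree `2 * r + 1` in `k` and its logarithm is bounded linearly; `2 * r + 2 ≤ (r + 1) ^
  -- 2` because `r ≥ 1`.
  have hpow : (k : ℝ) ^ (2 * r + 2) ≤ (k : ℝ) ^ ((r + 1) ^ 2) :=
    pow_le_pow_right₀ hk' (by nlinarith)
  push_cast
  calc a * ((k : ℝ) ^ (2 * r + 1) * (h + 1) * ((2 * r + 2) * k))
      = a * ((h + 1) * (2 * r + 2)) * (k : ℝ) ^ (2 * r + 2) := by ring
    _ ≤ _ := by gcongr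

theorem iterLog_succ (i n : ℕ) : iterLog (i + 1) n = Real.log (iterLog i n) :=
  Function.iterate_succ_apply' _ _ _

theorem iterate_exp_iterLog {n r : ℕ} (h : ∀ i < r, 0 < iterLog i n) :
    Real.exp^[r] (iterLog r n) = n := by
  induction r with
  | zero => rfl
  | succ r ih =>
    rw [Function.iterate_succ_apply, iterLog_succ, Real.exp_log (h r (by omega))]
    exact ih fun i hi => h i (by omega)

theorem iterLog_mono {m n j : ℕ} (hmn : m ≤ n) (h : ∀ i < j, 0 < iterLog i m) :
    iterLog j m ≤ iterLog j n := by
  induction j with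
  | zero => simpa [iterLog] using hmn
  | succ j ih =>
    rw [iterLog_succ, iterLog_succ]
    exact Real.log_le_log (h j (by omega)) (ih fun i hi => h i (by omega))

theorem iterLog_add_le {n r : ℕ} (h : ∀ i < r, 0 < iterLog i n) : iterLog r n + r ≤ n := by
  induction r with
  | zero => simp [iterLog]
  | succ r ih =>
    have h1 := Real.log_le_sub_one_of_pos (h r (by omega))
    have h2 := ih fun i hi => h i (by omega)
    rw [iterLog_succ]
    push_cast
    linarith

/-- By monotonicity the least admissible integer gives the minimum. This bounds the denominator in
the main estimate away from zero. -/
theorem exists_iterLog_lower_bound (j : ℕ) :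
    ∃ m : ℝ, 0 < m ∧ ∀ n : ℕ, (∀ i ≤ j, 0 < iterLog i n) → m ≤ iterLog j n := by
  classical
  by_cases hex : ∃ n : ℕ, ∀ i ≤ j, 0 < iterLog i n
  · refine ⟨iterLog j (Nat.find hex), Nat.find_spec hex j le_rfl, fun n hn => ?_⟩
    exact iterLog_mono (Nat.find_min' hex hn) fun i hi => Nat.find_spec hex i hi.le
  · exact ⟨1, one_pos, fun n hn => absurd ⟨n, hn⟩ hex⟩

end Tower

/-! ### Order transfer and the position coloring -/

section Transfer

variable {α β : Type*} [LinearOrder β] {V : Set α} {φ : α → β} {σ : α → ℕ}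

theorem image_filter_lt (hσ : ∀ a ∈ V, ∀ b ∈ V, φ a < φ b ↔ σ a < σ b) {e : Set α} (he : e ⊆ V)
    {x : α} (hx : x ∈ V) : {w ∈ φ '' e | w < φ x} = φ '' {v ∈ e | σ v < σ x} := by
  ext w
  constructor
  · rintro ⟨⟨v, hv, rfl⟩, hlt⟩
    exact ⟨v, ⟨hv, (hσ v (he hv) x hx).1 hlt⟩, rfl⟩
  · rintro ⟨v, ⟨hv, hlt⟩, rfl⟩
    exact ⟨⟨v, hv, rfl⟩, (hσ v (he hv) x hx).2 hlt⟩

theorem ncard_image_filter_lt (hφ : Set.InjOn φ V)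
    (hσ : ∀ a ∈ V, ∀ b ∈ V, φ a < φ b ↔ σ a < σ b) {e : Set α} (he : e ⊆ V)
    {x : α} (hx : x ∈ V) : {w ∈ φ '' e | w < φ x}.ncard = {v ∈ e | σ v < σ x}.ncard := by
  rw [image_filter_lt hσ he hx]
  exact (hφ.mono fun v hv => he hv.1).ncard_image

end Transfer

/-- Every finite set admits a labelling by `1, …, h` that is compatible with a given injection
into a linear order. -/
theorem exists_bijOn_lt_iff_lt {α β : Type*} [LinearOrder β] {V : Set α} (hV : V.Finite)
    {φ : α → β} (hφ : Set.InjOn φ V) :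
    ∃ σ : α → ℕ, Set.BijOn σ V (Set.Icc 1 V.ncard) ∧
      ∀ a ∈ V, ∀ b ∈ V, φ a < φ b ↔ σ a < σ b := by
  -- Counting with `≤` makes the labels start at 1.
  let σ : α → ℕ := fun x => {v ∈ V | φ v ≤ φ x}.ncard
  have hfin : ∀ x, {v ∈ V | φ v ≤ φ x}.Finite := fun x => hV.subset (Set.sep_subset _ _)
  have hlt : ∀ a, ∀ b ∈ V, φ a < φ b → σ a < σ b := by
    intro a b hb hab
    refine Set.ncard_lt_ncard ⟨fun v hv => ⟨hv.1, hv.2.trans hab.le⟩, fun hsub => ?_⟩ (hfin b)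
    exact absurd (hsub ⟨hb, le_rfl⟩).2 hab.not_ge
  have hinj : Set.InjOn σ V := by
    intro a ha b hb hab
    rcases lt_trichotomy (φ a) (φ b) with h | h | h
    · exact absurd hab (hlt a b hb h).ne
    · exact hφ ha hb h
    · exact absurd hab (hlt b a ha h).ne'
  have hmaps : Set.MapsTo σ V (Set.Icc 1 V.ncard) := fun x hx =>
    ⟨(Set.ncard_pos (hfin x)).2 ⟨x, hx, le_rfl⟩, Set.ncard_le_ncard (Set.sep_subset _ _) hV⟩
  refine ⟨σ, ⟨hmaps, hinj, ?_⟩, fun a ha b hb => ⟨hlt a b hb, fun hab => ?_⟩⟩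
  · have himg : σ '' V = Set.Icc 1 V.ncard := by
      refine Set.eq_of_subset_of_ncard_le hmaps.image_subset ?_ (Set.finite_Icc _ _)
      rw [hinj.ncard_image, ← Nat.card_coe_set_eq]
      simp
    exact himg.ge
  · by_contra hnot
    rcases (not_lt.1 hnot).lt_or_eq with h | h
    · exact absurd hab (hlt b a ha h).not_gt
    · rw [hφ hb ha h] at hab
      exact lt_irrefl _ hab

theorem ncard_sep_lt_lt {β : Type*} [LinearOrder β] {e : Set β} {v : β} (he : e.Finite)
    (hv : v ∈ e) : {w ∈ e | w < v}.ncard < e.ncard :=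
  Set.ncard_lt_ncard ⟨Set.sep_subset _ _, fun h => lt_irrefl v (h hv).2⟩ he

open Classical in
/-- The position of `v` relative to the `r`-set `e`, as a color. -/
noncomputable def positionColoring (n r : ℕ) (v : Fin n) (e : (completeRGraph n r).edgeSet) :
    Fin (2 * r + 1) :=
  have hr : (e : Set (Fin n)).ncard = r := by
    have := e.2
    simp only [completeRGraph, Set.mem_ofPred_eq] at this
    simp [Set.ncard, this]
  if hv : v ∈ (e : Set (Fin n)) then
    ⟨{w ∈ (e : Set (Fin n)) | w < v}.ncard, by
      have := ncard_sep_lt_lt (Set.toFinite _) hv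
      omega⟩
  else
    ⟨{w ∈ (e : Set (Fin n)) | w < v}.ncard + r, by
      have : {w ∈ (e : Set (Fin n)) | w < v}.ncard ≤ (e : Set (Fin n)).ncard :=
        Set.ncard_le_ncard (Set.sep_subset _ _) (Set.toFinite _)
      omega⟩

theorem isLocalColoring_positionColoring {α : Type*} {H : Hypergraph α} {r : ℕ}
    (hV : H.vertexSet.Finite) (hH : ¬ IsTwoLocallyLarge H r) (n : ℕ) :
    IsLocalColoring H (positionColoring n r) := by
  rintro T ⟨-, hTE, φ, hφ, rfl⟩
  obtain ⟨σ, hσ, hlt⟩ := exists_bijOn_lt_iff_lt hV hφ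
  by_contra hno
  refine hH ⟨σ, hσ, fun x hx => ?_⟩
  by_contra hsmall
  refine hno ⟨φ x, ⟨x, hx, rfl⟩, fun e₁ e₂ h₁ h₂ hne hcol => hsmall ?_⟩
  obtain ⟨e₁', he₁', hee₁⟩ := h₁
  obtain ⟨e₂', he₂', hee₂⟩ := h₂
  -- The shift by one appears because colors start at 0 and classes at 1.
  have hclass : ∀ (e : (completeRGraph n r).edgeSet) (e' : Set α), e' ∈ H.edgeSet →
      φ '' e' = e → e' ∈ edgeClass H r σ x ((positionColoring n r (φ x) e : ℕ) + 1) := by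
    intro e e' he' hee
    have hsub := he'.subset_vertexSet
    have hcount := ncard_image_filter_lt hφ hlt hsub hx
    have hbd := (positionColoring n r (φ x) e).2
    have hmem : φ x ∈ (e : Set (Fin n)) ↔ x ∈ e' := by
      rw [← hee]
      exact hφ.mem_image_iff hsub hx
    have hr : (e : Set (Fin n)).ncard = r := by
      have := e.2
      simp only [completeRGraph, Set.mem_ofPred_eq] at this
      simp [Set.ncard, this]
    refine ⟨he', ?_⟩
    rw [hee] at hcount
    by_cases hx' : x ∈ e'
    · have hv := hmem.2 hx'
      have := ncard_sep_lt_lt (Set.toFinite _) hv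
      have hval : (positionColoring n r (φ x) e : ℕ) =
          {w ∈ (e : Set (Fin n)) | w < φ x}.ncard := by
        simp only [positionColoring, dif_pos hv]
      exact .inl ⟨by omega, by omega, hx', by omega⟩
    · have hv := fun h => hx' (hmem.1 h)
      have hval : (positionColoring n r (φ x) e : ℕ) =
          {w ∈ (e : Set (Fin n)) | w < φ x}.ncard + r := by
        simp only [positionColoring, dif_neg hv]
      exact .inr ⟨by omega, by omega, hx', by omega⟩
  have hbd := (positionColoring n r (φ x) e₁).2
  refine ⟨(positionColoring n r (φ x) e₁ : ℕ) + 1, ⟨by omega, by omega⟩, ?_⟩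
  have h12 : e₁' ≠ e₂' := by
    rintro rfl
    exact hne (Subtype.ext (hee₁.symm.trans hee₂))
  have := Set.one_lt_encard_iff.2 ⟨e₁', e₂', hclass e₁ e₁' he₁' hee₁,
    hcol ▸ hclass e₂ e₂' he₂' hee₂, h12⟩
  exact Order.add_one_le_of_lt this

theorem localRainbowNumber_le {α : Type*} {H : Hypergraph α} {r : ℕ}
    (hV : H.vertexSet.Finite) (hH : ¬ IsTwoLocallyLarge H r) (n : ℕ) :
    localRainbowNumber r n H ≤ 2 * r + 1 :=
  Nat.sInf_le ⟨_, isLocalColoring_positionColoring hV hH n⟩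

/-! ### Lower bound for 2-locally large hypergraphs -/

theorem lt_ramseyBound_of_isLocalColoring {α : Type*} {H : Hypergraph α} {r h n k : ℕ} [NeZero k]
    (hr : IsRGraph H r) (hh : H.vertexSet.encard = h) (hh1 : 1 ≤ h) (hH : IsTwoLocallyLarge H r)
    {f : Fin n → (completeRGraph n r).edgeSet → Fin k} (hf : IsLocalColoring H f) :
    n < ramseyBound (k ^ (2 * r + 1)) (h + 1) r := by
  classical
  by_contra! hn
  let g : Fin n → Finset (Fin n) → Fin k := fun x e =>
    if he : (e : Set (Fin n)).encard = r then f x ⟨e, he⟩ else 0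
  obtain ⟨S, -, hSc, hS⟩ := exists_color_determined_by_rank r h g Finset.univ (by simpa using hn)
  obtain ⟨σ, hσ, hlarge⟩ := hH
  have hcard : H.vertexSet.ncard = h := by simp [Set.ncard, hh]
  rw [hcard] at hσ
  -- On vertices of `H` the index is `σ a - 1 < h`; the remainder only makes `φ` total.
  let φ : α → Fin n := fun a => S.orderEmbOfFin hSc ⟨(σ a - 1) % h, Nat.mod_lt _ hh1⟩
  have hφS : ∀ a, φ a ∈ S := fun a => S.orderEmbOfFin_mem hSc _
  have hlt : ∀ a ∈ H.vertexSet, ∀ b ∈ H.vertexSet, φ a < φ b ↔ σ a < σ b := by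
    intro a ha b hb
    obtain ⟨ha1, ha2⟩ := hσ.mapsTo ha
    obtain ⟨hb1, hb2⟩ := hσ.mapsTo hb
    simp only [φ, OrderEmbedding.lt_iff_lt, Fin.mk_lt_mk]
    rw [Nat.mod_eq_of_lt (by omega), Nat.mod_eq_of_lt (by omega)]
    omega
  have hφ : Set.InjOn φ H.vertexSet := by
    intro a ha b hb hab
    refine hσ.injOn ha hb ?_
    have h1 := hlt a ha b hb
    have h2 := hlt b hb a ha
    rw [hab] at h1 h2
    simp only [lt_irrefl, false_iff] at h1 h2
    omega
  have hedge : ∀ e ∈ H.edgeSet, (φ '' e).encard = r := fun e he => by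
    rw [(hφ.mono he.subset_vertexSet).encard_image, hr e he]
  obtain ⟨u, ⟨x, hx, rfl⟩, hrain⟩ := hf (H.image φ)
    ⟨Set.subset_univ _, by rintro _ ⟨e, he, rfl⟩; exact hedge e he, φ, hφ, rfl⟩
  obtain ⟨i, -, hi⟩ := hlarge x hx
  obtain ⟨e₁, e₂, he₁, he₂, hne⟩ := Set.one_lt_encard_iff.1
    (lt_of_lt_of_le (by norm_num) hi : 1 < (edgeClass H r σ x i).encard)
  refine hrain ⟨φ '' e₁, hedge e₁ he₁.1⟩ ⟨φ '' e₂, hedge e₂ he₂.1⟩ ⟨e₁, he₁.1, rfl⟩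
    ⟨e₂, he₂.1, rfl⟩ ?_ ?_
  · intro heq
    exact hne ((hφ.image_eq_image_iff he₁.1.subset_vertexSet he₂.1.subset_vertexSet).1
      (congrArg Subtype.val heq))
  have hg : ∀ e (he : e ∈ H.edgeSet),
      f (φ x) ⟨φ '' e, hedge e he⟩ = g (φ x) (φ '' e).toFinset := by
    intro e he
    have : (((φ '' e).toFinset : Finset (Fin n)) : Set (Fin n)).encard = r := by
      rw [Set.coe_toFinset, hedge e he]
    simp only [g, dif_pos this, Set.coe_toFinset]
  have hsub : ∀ e, (φ '' e).toFinset ⊆ S := by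
    intro e w hw
    obtain ⟨a, -, rfl⟩ := Set.mem_toFinset.1 hw
    exact hφS a
  have hcd : ∀ e ∈ H.edgeSet, (φ '' e).toFinset.card = r := by
    intro e he
    rw [← Set.ncard_eq_toFinset_card', Set.ncard, hedge e he]
    simp
  have hmem : ∀ e ∈ H.edgeSet, φ x ∈ (φ '' e).toFinset ↔ x ∈ e := fun e he => by
    rw [Set.mem_toFinset]
    exact hφ.mem_image_iff he.subset_vertexSet hx
  have hrank : ∀ e ∈ H.edgeSet, rank (φ x) (φ '' e).toFinset = {v ∈ e | σ v < σ x}.ncard := by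
    intro e he
    rw [← ncard_image_filter_lt hφ hlt he.subset_vertexSet hx, rank, ← Set.ncard_coe_finset]
    congr 1
    ext w
    simp
  rw [hg e₁ he₁.1, hg e₂ he₂.1]
  obtain ⟨hE₁, hc₁⟩ := he₁
  obtain ⟨hE₂, hc₂⟩ := he₂
  refine hS (φ x) (hφS x) _ (hsub e₁) _ (hsub e₂) (hcd e₁ hE₁) (hcd e₂ hE₂) ?_ ?_
  · rw [hmem e₁ hE₁, hmem e₂ hE₂]
    rcases hc₁ with ⟨h1, h2, h3, h4⟩ | ⟨h1, h2, h3, h4⟩ <;>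
      rcases hc₂ with ⟨h5, h6, h7, h8⟩ | ⟨h5, h6, h7, h8⟩
    · exact iff_of_true h3 h7
    · omega
    · omega
    · exact iff_of_false h3 h7
  · rw [hrank e₁ hE₁, hrank e₂ hE₂]
    omega

/-- If `r ≤ n`, then `K_n^{(r)}` has an edge, so that a coloring needs at least one color. -/
theorem pos_of_coloring {n r k : ℕ} (hr : 1 ≤ r) (hrn : r ≤ n)
    (f : Fin n → (completeRGraph n r).edgeSet → Fin k) : 1 ≤ k := by
  obtain ⟨e, -, he⟩ := Finset.exists_subset_card_eq (s := (Finset.univ : Finset (Fin n)))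
    (n := r) (by simpa using hrn)
  have hmem : (e : Set (Fin n)) ∈ (completeRGraph n r).edgeSet := by
    simp [completeRGraph, he]
  have := (f ⟨0, by omega⟩ ⟨e, hmem⟩).2
  omega

/-- A 2-locally large `r`-graph forces `n` to be at most a tower of height `r` over a polynomial in
the local rainbow coloring number. -/
theorem exists_lt_iterate_exp (r h : ℕ) (hr : 1 ≤ r) (hh : 1 ≤ h) :
    ∃ D : ℝ, 0 < D ∧ ∀ (α : Type*) (H : Hypergraph α), IsRGraph H r → H.vertexSet.encard = h →
      IsTwoLocallyLarge H r → ∀ n : ℕ, r ≤ n →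
        (n : ℝ) < Real.exp^[r] (D * (localRainbowNumber r n H : ℝ) ^ ((r + 1) ^ 2)) := by
  obtain ⟨D, hD, hbound⟩ := exists_ramseyBound_pow_le r h hr
  refine ⟨D, hD, fun α H hH hV hlarge n hn => ?_⟩
  have hne : H.vertexSet.Nonempty := by
    rw [← Set.encard_pos, hV]
    exact_mod_cast hh
  obtain ⟨f, hf⟩ := Nat.sInf_mem (exists_isLocalColoring r n H hne)
  have hk : 1 ≤ localRainbowNumber r n H := pos_of_coloring hr hn f
  have : NeZero (localRainbowNumber r n H) := ⟨by omega⟩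
  have hlt : n < ramseyBound (localRainbowNumber r n H ^ (2 * r + 1)) (h + 1) r :=
    lt_ramseyBound_of_isLocalColoring (k := localRainbowNumber r n H) hH hV hh hlarge hf
  exact lt_of_lt_of_le (by exact_mod_cast hlt) (hbound _ hk)

end LocalRainbow

theorem mainTheorem2 (r h : ℕ) (hr : 1 ≤ r) (hh : 1 ≤ h) :
    ∃ c : ℝ, 0 < c ∧
      ∀ (α : Type*) (H : Hypergraph α), LocalRainbow.IsRGraph H r → H.vertexSet.encard = h →
        (¬ LocalRainbow.IsTwoLocallyLarge H r →
          ∀ n : ℕ, LocalRainbow.localRainbowNumber r n H ≤ 2 * r + 1) ∧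
        (LocalRainbow.IsTwoLocallyLarge H r →
          ∀ n : ℕ, (∀ i ≤ r + 1, 0 < LocalRainbow.iterLog i n) →
            c * (LocalRainbow.iterLog r n / LocalRainbow.iterLog (r + 1) n) ^
                (1 / ((r : ℝ) + 1) ^ 2) ≤
              (LocalRainbow.localRainbowNumber r n H : ℝ)) ∧
        ((∃ C : ℕ, ∀ n : ℕ, LocalRainbow.localRainbowNumber r n H ≤ C) ↔
          ¬ LocalRainbow.IsTwoLocallyLarge H r) := by
  obtain ⟨D, hD, hlt⟩ := LocalRainbow.exists_lt_iterate_exp r h hr hh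
  obtain ⟨m, hm, hmn⟩ := LocalRainbow.exists_iterLog_lower_bound (r + 1)
  have hDm : 0 < (D / m) ^ (1 / ((r : ℝ) + 1) ^ 2) := Real.rpow_pos_of_pos (by positivity) _
  refine ⟨((D / m) ^ (1 / ((r : ℝ) + 1) ^ 2))⁻¹, by positivity, fun α H hH hV => ?_⟩
  have hfin : H.vertexSet.Finite := Set.finite_of_encard_eq_coe hV
  refine ⟨LocalRainbow.localRainbowNumber_le hfin, fun hlarge n hn => ?_,
    ⟨fun ⟨C, hC⟩ hlarge => ?_, fun hsmall =>
      ⟨2 * r + 1, LocalRainbow.localRainbowNumber_le hfin hsmall⟩⟩⟩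
  · set k := LocalRainbow.localRainbowNumber r n H with hk
    have hpos := hn r (by omega)
    have hrn : r ≤ n := by
      have := LocalRainbow.iterLog_add_le (n := n) (r := r) fun i hi => hn i (by omega)
      exact_mod_cast (by linarith : (r : ℝ) ≤ n)
    have h1 := hlt α H hH hV hlarge n hrn
    rw [← LocalRainbow.iterate_exp_iterLog (n := n) (r := r) fun i hi => hn i (by omega),
      (LocalRainbow.strictMono_iterate_exp r).lt_iff_lt] at h1
    have h2 : LocalRainbow.iterLog r n / LocalRainbow.iterLog (r + 1) n ≤
        D / m * (k : ℝ) ^ ((r + 1) ^ 2) := by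
      calc _ ≤ (D * (k : ℝ) ^ ((r + 1) ^ 2)) / m :=
            div_le_div₀ (by positivity) h1.le hm (hmn n hn)
        _ = _ := by ring
    rw [inv_mul_le_iff₀ hDm]
    calc _ ≤ (D / m * (k : ℝ) ^ ((r + 1) ^ 2)) ^ (1 / ((r : ℝ) + 1) ^ 2) :=
          Real.rpow_le_rpow (div_nonneg hpos.le (hn (r + 1) le_rfl).le) h2 (by positivity)
      _ = _ := by
          rw [Real.mul_rpow (by positivity) (by positivity)]
          congr 1
          have := Real.pow_rpow_inv_natCast (x := (k : ℝ)) (n := (r + 1) ^ 2) (by positivity)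
            (by positivity)
          push_cast at this
          rw [one_div]
          exact this
  -- A bound `C` on the number of colors would bound every `n ≥ r` by a fixed tower.
  · obtain ⟨N, hN⟩ := exists_nat_ge (Real.exp^[r] (D * (C : ℝ) ^ ((r + 1) ^ 2)))
    have h1 := hlt α H hH hV hlarge (max N r) (le_max_right _ _)
    have h2 : ((LocalRainbow.localRainbowNumber r (max N r) H : ℕ) : ℝ) ≤ C := by
      exact_mod_cast hC _
    have h3 : Real.exp^[r]
        (D * (LocalRainbow.localRainbowNumber r (max N r) H : ℝ) ^ ((r + 1) ^ 2)) ≤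
        Real.exp^[r] (D * (C : ℝ) ^ ((r + 1) ^ 2)) :=
      (LocalRainbow.strictMono_iterate_exp r).monotone (by gcongr)
    have h4 : (N : ℝ) ≤ (max N r : ℕ) := by exact_mod_cast le_max_left _ _
    linarith
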